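/- Let $d\ge 1$ and let $\rho\in\mathbb{R}^d$ with $\|\rho\|_2\le 1$. Let $X$ be a standard Gaussian vector in $\mathbb{R}^d$ and $Y=\rho^TX+\sqrt{1-\|\rho\|_2^2}\,Z$, where $Z\sim\mathcal N(0,1)$ is independent of $X$, and let $(X_t,Y_t)_{t=1}^n$ be $n$ independent copies of $(X,Y)$. Party 1 observes $X^n=(X_1,\dots,X_n)$, party 2 observes $Y^n=(Y_1,\dots,Y_n)$, and both observe a shared random variable $V$ of any chosen distribution, independent of $(X^n,Y^n)$. A one-way test of communication length $\ell$ and observation length $n$ consists of $V$, a message $\Pi=f(X^n,V)\in\{0,1\}^\ell$ sent by party 1, and a decision $g(Y^n,\Pi,V)\in\{0,1\}$ of party 2. For $\delta,\varepsilon\in(0,1)$ and $\tau\in(0,1]$ it is an $(\ell,\delta,\varepsilon,\tau)$-test if \[ \mathbb{P}_\rho[g(Y^n,\Pi,V)=1]\le\delta\ \text{ for every } \rho \text{ with } \tau\le\|\rho\|_2\le 1,\qquad \mathbb{P}_0[g(Y^n,\Pi,V)=0]\le\varepsilon , \] where $\mathbb P_\rho$ is the probability when the correlation vector is $\rho$.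 Let $C_d^1(\delta,\varepsilon,\tau)$ be the least $\ell$ such that an $(\ell,\delta,\varepsilon,\tau)$-test with observation length $n$ exists for all sufficiently large $n$ ($\infty$ if there is no such $\ell$). Theorem 2. There are absolute constants $c,K>0$ such that for all integers $d\ge1$, all $\tau\in(0,1]$ and all $\delta,\varepsilon\in(0,1)$, \[ C_d^1(\delta,\varepsilon,\tau)\le c\cdot\frac{d}{\tau^2}\cdot\max\left\{\log_2\frac1\delta,\log_2\frac1\varepsilon\right\}+K\ln\frac{d}{\tau^2}. \] -/

import Mathlib

open MeasureTheory ProbabilityTheory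
open scoped ENNReal

namespace CorrelationTesting

/-- The joint law of `(X, Y)` on `ℝ^d × ℝ`: `X` is standard Gaussian on `ℝ^d`, and
`Y = ∑ i, ρ i * X i + √(1 - ‖ρ‖²) * Z` with `Z` standard normal, independent of `X`.
It is used for `‖ρ‖ ≤ 1`, where `‖ρ‖` is the Euclidean norm. -/
noncomputable def pairLaw {d : ℕ} (ρ : EuclideanSpace ℝ (Fin d)) : Measure ((Fin d → ℝ) × ℝ) :=
  ((Measure.pi fun _ : Fin d => gaussianReal 0 1).prod (gaussianReal 0 1)).map
    fun p => (p.1, ∑ i, ρ i * p.1 i + √(1 - ‖ρ‖ ^ 2) * p.2)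

instance {d : ℕ} (ρ : EuclideanSpace ℝ (Fin d)) : IsProbabilityMeasure (pairLaw ρ) :=
  Measure.isProbabilityMeasure_map (by fun_prop)

/-- The law of `n` independent copies `(X_t, Y_t)` of `(X, Y)`. -/
noncomputable def sampleLaw {d : ℕ} (n : ℕ) (ρ : EuclideanSpace ℝ (Fin d)) :
    Measure (Fin n → (Fin d → ℝ) × ℝ) :=
  Measure.pi fun _ => pairLaw ρ

/-- A one-way (that is, one-round) distributed test with observation length `n` and
communication length `ℓ`. The first party observes `X^n`, the second `Y^n`, and both observe a
shared random variable with values in `V`. The first party sends the `ℓ` bits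
`encode (X^n, V)`; the second party outputs `decision (Y^n, message, V)`, where `false` stands for
the decision `0` (correlated) and `true` for the decision `1` (independent). -/
structure OneWayTest (d n ℓ : ℕ) : Type 1 where
  /-- the range of the shared randomness -/
  V : Type
  [measurableSpace : MeasurableSpace V]
  /-- the law of the shared randomness -/
  law : Measure V
  [isProbabilityMeasure : IsProbabilityMeasure law]
  /-- the message of the first party -/
  encode : (Fin n → Fin d → ℝ) × V → (Fin ℓ → Bool)
  measurable_encode : Measurable encode
  /-- the decision of the second party -/
  decision : (Fin n → ℝ) × (Fin ℓ → Bool) × V → Bool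
  measurable_decision : Measurable decision

attribute [instance] OneWayTest.measurableSpace OneWayTest.isProbabilityMeasure

namespace OneWayTest

variable {d n ℓ : ℕ}

/-- The output of the test on the samples `s t = (X_t, Y_t)` and the shared randomness `v`. -/
def output (T : OneWayTest d n ℓ) (s : Fin n → (Fin d → ℝ) × ℝ) (v : T.V) : Bool :=
  T.decision (fun t => (s t).2, T.encode (fun t => (s t).1, v), v)

/-- The probability that the test outputs `b` when the correlation vector is `ρ`; the shared
randomness is independent of the samples. -/
noncomputable def probOutput (T : OneWayTest d n ℓ) (ρ : EuclideanSpace ℝ (Fin d)) (b : Bool) : ℝ :=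
  ((sampleLaw n ρ).prod T.law).real {ω | T.output ω.1 ω.2 = b}

/-- `T` errs with probability at most `δ` under every `ρ` with `‖ρ‖ ≥ τ`, and with probability
at most `ε` under `ρ = 0`. -/
def IsValid (T : OneWayTest d n ℓ) (δ ε τ : ℝ) : Prop :=
  (∀ ρ : EuclideanSpace ℝ (Fin d), ‖ρ‖ ≤ 1 → τ ≤ ‖ρ‖ → T.probOutput ρ true ≤ δ) ∧
    T.probOutput 0 false ≤ ε

end OneWayTest

/-- The communication length `ℓ` suffices: for all sufficiently large `n` there is a valid one-way
test with observation length `n` and communication length `ℓ`. -/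
def Achievable (d : ℕ) (δ ε τ : ℝ) (ℓ : ℕ) : Prop :=
  ∃ N : ℕ, ∀ n ≥ N, ∃ T : OneWayTest d n ℓ, T.IsValid δ ε τ

/-- The minimum one-way communication for `d`-dimensional correlation testing: the least
achievable `ℓ`, and `⊤` if there is none. -/
noncomputable def minOneWayComm (d : ℕ) (δ ε τ : ℝ) : ℕ∞ :=
  ⨅ (ℓ : ℕ) (_ : Achievable d δ ε τ ℓ), (ℓ : ℕ∞)

end CorrelationTesting

/-! Cut the samples into `8 * K` blocks of length `m` of order `d / τ ^ 2`. Each block has a shared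
uniform sign vector `u`, and party 1 sends the sign of `⟨u, X_t⟩` for every sample used. Party 2
multiplies these signs by `Y_t` and sums over the block.

A summand has variance at most 1 and mean `signCorr d * ⟨u, ρ⟩`, where `signCorr d ≥ 1 / (3 * √d)`
(`integral_score`, `signCorr_ge`). If `ρ = 0`, Chebyshev makes a sum of size `8 * √m` rare. If `‖ρ‖
≥ τ`, Paley–Zygmund gives `|⟨u, ρ⟩| ≥ ‖ρ‖ / 2` with probability at least 1/5 over `u`; the mean is
then at least `16 * √m` in absolute value, and Chebyshev makes the block fire.

Thus a block fires with probability at most 1/64 under independence and at least 1/5 - 1/64 under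
correlation. The threshold of `K` firing blocks out of `8 * K` separates the two, and Chernoff
bounds both errors by `(15 / 16) ^ K`. Taking `K` proportional to the larger logarithm gives the
bound; the additive logarithmic term is only slack. -/

namespace CorrelationTesting

/-! ### Moments and anticoncentration of random sign sums -/

/-- The sign `±1` encoded by a bit. -/
def sgn (b : Bool) : ℝ := if b then 1 else -1

lemma sgn_sq (b : Bool) : sgn b ^ 2 = 1 := by cases b <;> simp [sgn]

lemma sgn_mul_self (b : Bool) : sgn b * sgn b = 1 := by cases b <;> simp [sgn]

/-- Splitting off the first sign is the induction step for both moment computations. -/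
lemma sum_signs_succ {d : ℕ} (F : ℝ → ℝ) (a : Fin (d + 1) → ℝ) :
    ∑ u : Fin (d + 1) → Bool, F (∑ i, sgn (u i) * a i) =
      ∑ u : Fin d → Bool, (F (a 0 + ∑ i, sgn (u i) * a i.succ) +
        F (-a 0 + ∑ i, sgn (u i) * a i.succ)) := by
  rw [← (Fin.consEquiv fun _ => Bool).sum_comp, Fintype.sum_prod_type]
  simp [Fin.sum_univ_succ, Fin.consEquiv, sgn, Finset.sum_add_distrib]

lemma sum_signs_sq {d : ℕ} (a : Fin d → ℝ) :
    ∑ u : Fin d → Bool, (∑ i, sgn (u i) * a i) ^ 2 = 2 ^ d * ∑ i, a i ^ 2 := by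
  induction d with
  | zero => simp
  | succ d ih =>
    rw [sum_signs_succ (fun x => x ^ 2), Fin.sum_univ_succ]
    have h : ∀ x : ℝ, (a 0 + x) ^ 2 + (-a 0 + x) ^ 2 = 2 * a 0 ^ 2 + 2 * x ^ 2 := fun x => by ring
    simp only [h, Finset.sum_add_distrib, ← Finset.mul_sum, ih]
    simp
    ring

/-- Odd powers cancel when the first sign is averaged; with the constant 3 the cross terms on the
two sides agree exactly. -/
lemma sum_signs_pow_four_le {d : ℕ} (a : Fin d → ℝ) :
    ∑ u : Fin d → Bool, (∑ i, sgn (u i) * a i) ^ 4 ≤ 3 * 2 ^ d * (∑ i, a i ^ 2) ^ 2 := by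
  induction d with
  | zero => simp
  | succ d ih =>
    rw [sum_signs_succ (fun x => x ^ 4), Fin.sum_univ_succ]
    have h : ∀ x : ℝ, (a 0 + x) ^ 4 + (-a 0 + x) ^ 4 =
      2 * a 0 ^ 4 + 12 * a 0 ^ 2 * x ^ 2 + 2 * x ^ 4 := fun x => by ring
    simp only [h, Finset.sum_add_distrib, ← Finset.mul_sum, sum_signs_sq]
    have := ih fun i => a i.succ
    have h4 : (0 : ℝ) ≤ 2 ^ d * a 0 ^ 4 := by positivity
    simp
    ring_nf at this h4 ⊢
    linarith

/-- A Paley–Zygmund bound for sums of random signs. -/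
lemma card_small_signs_sum_le {d : ℕ} (a : Fin d → ℝ) :
    ((Finset.univ.filter fun u : Fin d → Bool =>
      (∑ i, sgn (u i) * a i) ^ 2 < (∑ i, a i ^ 2) / 4).card : ℝ) ≤ 4 / 5 * 2 ^ d := by
  set Q := ∑ i, a i ^ 2 with hQ
  have hQ0 : 0 ≤ Q := Finset.sum_nonneg fun i _ => sq_nonneg _
  rcases hQ0.eq_or_lt with h0 | hpos
  · rw [← h0, Finset.filter_false_of_mem]
    · simp
    · intro u _; simpa using sq_nonneg _
  rw [Finset.card_filter]
  push_cast
  -- The right side is the square of `Q - 3/10 * (W - Q/4)`, so it dominates the indicator. Its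
  -- average needs only the second and fourth moments and is about `0.781 * Q ^ 2`.
  have key : ∀ u : Fin d → Bool,
      Q ^ 2 * (if (∑ i, sgn (u i) * a i) ^ 2 < Q / 4 then (1 : ℝ) else 0) ≤
        Q ^ 2 - (3 / 5 * Q * ((∑ i, sgn (u i) * a i) ^ 2 - Q / 4) -
          9 / 100 * ((∑ i, sgn (u i) * a i) ^ 2 - Q / 4) ^ 2) := by
    intro u
    set W := (∑ i, sgn (u i) * a i) ^ 2
    split_ifs with h
    · nlinarith [sq_nonneg (W - Q / 4), mul_nonneg hQ0 (sub_nonneg.2 h.le)]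
    · nlinarith [sq_nonneg (Q - 3 / 10 * (W - Q / 4))]
  have hs := Finset.sum_le_sum fun u (_ : u ∈ Finset.univ) => key u
  rw [← Finset.mul_sum] at hs
  have e : ∀ x : ℝ, Q ^ 2 - (3 / 5 * Q * (x ^ 2 - Q / 4) - 9 / 100 * (x ^ 2 - Q / 4) ^ 2) =
      Q ^ 2 * (1 + 3 / 20 + 9 / 1600) - (3 / 5 + 9 / 200) * Q * x ^ 2 + 9 / 100 * x ^ 4 :=
    fun x => by ring
  simp only [e, Finset.sum_add_distrib, Finset.sum_sub_distrib, ← Finset.mul_sum,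
    sum_signs_sq, ← hQ] at hs
  have h4 := sum_signs_pow_four_le a
  simp only [Finset.sum_const, Finset.card_univ, Fintype.card_fun, Fintype.card_bool,
    Fintype.card_fin, nsmul_eq_mul, Nat.cast_pow, Nat.cast_ofNat] at hs
  rw [← hQ] at h4
  refine le_of_mul_le_mul_left (hs.trans ?_) (pow_pos hpos 2)
  have : 0 ≤ Q ^ 2 * 2 ^ d := by positivity
  nlinarith

/-! ### Chernoff bound and independence of blocks -/

section Measure

variable {W : Type*} [MeasurableSpace W]

/-- Chernoff's bound for the number of coordinates that lie in a given set. -/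
lemma chernoff_count (ν : Measure W) [IsProbabilityMeasure ν] {A : Set W} [DecidablePred (· ∈ A)]
    (hA : MeasurableSet A) {p x : ℝ} (hp : ν.real A ≤ p) (hx : 0 ≤ x) (J K : ℕ) :
    (Measure.pi fun _ : Fin J => ν).real {w | K ≤ ∑ j, if w j ∈ A then 1 else 0} ≤
      (1 + x * p) ^ J / (1 + x) ^ K := by
  have hf : Integrable (fun y => 1 + x * A.indicator (fun _ => (1 : ℝ)) y) ν :=
    (integrable_const _).add (((integrable_const _).indicator hA).const_mul _)
  have hint : ∫ y, (1 + x * A.indicator (fun _ => (1 : ℝ)) y) ∂ν = 1 + x * ν.real A := by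
    rw [integral_add (integrable_const _) (((integrable_const _).indicator hA).const_mul _),
      integral_const_mul, integral_indicator_const _ hA]
    simp
  have hI := integral_fintype_prod_eq_pow (𝕜 := ℝ) (ι := Fin J) (μ := ν)
    (fun y => 1 + x * A.indicator (fun _ => (1 : ℝ)) y)
  have hprod : ∀ w : Fin J → W, ∏ j, (1 + x * A.indicator (fun _ => (1 : ℝ)) (w j)) =
      (1 + x) ^ (∑ j, if w j ∈ A then 1 else 0) := by
    intro w
    rw [← Finset.prod_pow_eq_pow_sum]
    refine Finset.prod_congr rfl fun j _ => ?_
    by_cases h : w j ∈ A <;> simp [h]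
  -- Markov's inequality for `(1 + x) ^ count`, whose expectation factors over the coordinates.
  have hM := mul_meas_ge_le_integral_of_nonneg (μ := Measure.pi fun _ : Fin J => ν)
    (f := fun w => ∏ j, (1 + x * A.indicator (fun _ => (1 : ℝ)) (w j)))
    (Filter.Eventually.of_forall fun w => by
      simp only [hprod]; positivity)
    (Integrable.fintype_prod fun _ => hf) ((1 + x) ^ K)
  rw [hI, hint, Fintype.card_fin] at hM
  rw [le_div_iff₀ (by positivity), mul_comm]
  refine (mul_le_mul_of_nonneg_left (measureReal_mono ?_) (by positivity)).trans (hM.trans ?_)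
  · intro w hw
    simp only [Set.mem_ofPred_eq, hprod] at hw ⊢
    exact pow_le_pow_right₀ (by linarith) hw
  · gcongr

/-- Restricting a family of independent variables along an injection. -/
lemma measurePreserving_comp_injective {ι κ : Type*} [Fintype ι] [Fintype κ] (μ : Measure W)
    [IsProbabilityMeasure μ] {g : κ → ι} (hg : Function.Injective g) :
    MeasurePreserving (fun (s : ι → W) k => s (g k)) (Measure.pi fun _ => μ)
      (Measure.pi fun _ => μ) := by
  classical
  refine ⟨by fun_prop, Eq.symm (Measure.pi_eq fun s hs => ?_)⟩
  rw [Measure.map_apply (by fun_prop) (MeasurableSet.univ_pi hs)]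
  -- The preimage of a box is a box, unconstrained in the coordinates outside the range of `g`.
  have : (fun (s : ι → W) k => s (g k)) ⁻¹' Set.univ.pi s =
      Set.univ.pi fun i => if h : ∃ k, g k = i then s h.choose else Set.univ := by
    ext w
    simp only [Set.mem_preimage, Set.mem_univ_pi]
    constructor
    · intro h i
      split_ifs with hi
      · have := h hi.choose
        rwa [hi.choose_spec] at this
      · trivial
    · intro h k
      have := h (g k)
      have hk : ∃ k', g k' = g k := ⟨k, rfl⟩
      rw [dif_pos hk, hg hk.choose_spec] at this
      exact this
  rw [this, Measure.pi_pi, ← Finset.prod_subset (Finset.subset_univ (Finset.univ.image g)),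
    Finset.prod_image hg.injOn]
  · refine Finset.prod_congr rfl fun k _ => ?_
    have hk : ∃ k', g k' = g k := ⟨k, rfl⟩
    rw [dif_pos hk, hg hk.choose_spec]
  · intro i _ hi
    rw [dif_neg]
    · simp
    · rintro ⟨k, rfl⟩; simp at hi

/-- Splitting independent samples into independent blocks with independent shared randomness. -/
lemma measurePreserving_blocks {V : Type*} [MeasurableSpace V] {n J m : ℕ} (μ : Measure W)
    [IsProbabilityMeasure μ] (lam : Measure V) [IsProbabilityMeasure lam]
    {g : Fin J × Fin m → Fin n} (hg : Function.Injective g) :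
    MeasurePreserving (fun (p : (Fin n → W) × (Fin J → V)) j => (fun k => p.1 (g (j, k)), p.2 j))
      ((Measure.pi fun _ => μ).prod (Measure.pi fun _ => lam))
      (Measure.pi fun _ => (Measure.pi fun _ => μ).prod lam) := by
  have h1 := measurePreserving_comp_injective μ hg
  have h2 : MeasurePreserving (MeasurableEquiv.curry (Fin J) (Fin m) W) (Measure.pi fun _ => μ)
      (Measure.pi fun _ => Measure.pi fun _ => μ) := by
    refine ⟨by fun_prop, ?_⟩
    have := Measure.infinitePi_map_curry (ι := Fin J) (κ := Fin m) (fun _ _ => μ)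
    simpa only [Measure.infinitePi_eq_pi] using this
  have h3 := (h2.comp h1).prod (MeasurePreserving.id (Measure.pi fun _ : Fin J => lam))
  exact (measurePreserving_arrowProdEquivProdArrow (Fin m → W) V (Fin J) _ _).symm.comp h3

end Measure

/-! ### Correlation of a Gaussian vector with the sign of a projection -/

/-- The standard Gaussian measure on `ℝ^d`. -/
noncomputable def gaussianPi (d : ℕ) : Measure (Fin d → ℝ) := Measure.pi fun _ => gaussianReal 0 1

instance (d : ℕ) : IsProbabilityMeasure (gaussianPi d) := by unfold gaussianPi; infer_instance

/-- The random sign `±1` that records on which side of a hyperplane a point lies. -/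
noncomputable def sgnReal (x : ℝ) : ℝ := sgn (decide (0 ≤ x))

lemma measurable_sgnReal : Measurable sgnReal := by
  have e : sgnReal = fun x : ℝ => if x ∈ Set.Ici 0 then (1 : ℝ) else -1 := by
    ext x; simp [sgnReal, sgn]
  rw [e]
  exact Measurable.ite measurableSet_Ici measurable_const measurable_const

lemma sgnReal_sq (x : ℝ) : sgnReal x ^ 2 = 1 := sgn_sq _

lemma norm_sgnReal (x : ℝ) : ‖sgnReal x‖ = 1 := by
  unfold sgnReal sgn; split_ifs <;> simp

lemma sgnReal_mul_self (x : ℝ) : sgnReal x * x = |x| := by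
  unfold sgnReal sgn
  by_cases h : 0 ≤ x
  · simp [h, abs_of_nonneg]
  · simp [h, abs_of_neg (not_le.1 h)]

lemma memLp_coord {d : ℕ} (i : Fin d) : MemLp (fun x : Fin d → ℝ => x i) 2 (gaussianPi d) :=
  (memLp_id_gaussianReal 2).comp_measurePreserving
    (measurePreserving_eval (fun _ : Fin d => gaussianReal 0 1) i)

lemma integrable_coord {d : ℕ} (i : Fin d) : Integrable (fun x : Fin d → ℝ => x i) (gaussianPi d) :=
  (memLp_coord i).integrable (by norm_num)

lemma integrable_sgnReal_mul {Ω : Type*} [MeasurableSpace Ω] {μ : Measure Ω} {f g : Ω → ℝ}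
    (hf : Measurable f) (hg : Integrable g μ) : Integrable (fun x => sgnReal (f x) * g x) μ :=
  hg.bdd_mul (c := 1) (measurable_sgnReal.comp hf).aestronglyMeasurable
    (Filter.Eventually.of_forall fun _ => (norm_sgnReal _).le)

lemma integral_comp_measurePreserving {Ω : Type*} [MeasurableSpace Ω] {μ : Measure Ω} {T : Ω → Ω}
    (hT : MeasurePreserving T μ μ) {f : Ω → ℝ} (hf : Measurable f) :
    ∫ x, f (T x) ∂μ = ∫ x, f x ∂μ := by
  conv_rhs => rw [← hT.map_eq]
  exact (integral_map hT.aemeasurable hf.aestronglyMeasurable).symm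

/-- The correlation of one coordinate of a standard Gaussian vector with the sign of the sum of
all its coordinates. -/
noncomputable def signCorr (d : ℕ) : ℝ := (∫ x, |∑ c, x c| ∂gaussianPi d) / d

/-- Swapping coordinates shows that the integral does not depend on `i`, and the sum over all `i` is
the mean of `|∑ c, x c|`. -/
lemma integral_sgnReal_sum_mul {d : ℕ} (i : Fin d) :
    ∫ x, sgnReal (∑ c, x c) * x i ∂gaussianPi d = signCorr d := by
  have hsymm : ∀ j, ∫ x, sgnReal (∑ c, x c) * x j ∂gaussianPi d =
      ∫ x, sgnReal (∑ c, x c) * x i ∂gaussianPi d := by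
    intro j
    have hmp : MeasurePreserving (fun (x : Fin d → ℝ) k => x (Equiv.swap i j k))
        (gaussianPi d) (gaussianPi d) :=
      measurePreserving_comp_injective (gaussianReal 0 1) (Equiv.swap i j).injective
    have hmeas : Measurable fun x : Fin d → ℝ => sgnReal (∑ c, x c) * x j :=
      (measurable_sgnReal.comp (by fun_prop)).mul (by fun_prop)
    rw [← integral_comp_measurePreserving hmp hmeas]
    have e : ∀ x : Fin d → ℝ, ∑ c, x (Equiv.swap i j c) = ∑ c, x c := fun x =>
      Equiv.sum_comp (Equiv.swap i j) x
    simp_rw [e, Equiv.swap_apply_right]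
  have hsum : ∑ j, ∫ x, sgnReal (∑ c, x c) * x j ∂gaussianPi d =
      ∫ x, |∑ c, x c| ∂gaussianPi d := by
    rw [← integral_finsetSum _ fun j _ =>
      integrable_sgnReal_mul (by fun_prop) (integrable_coord j)]
    simp_rw [← Finset.mul_sum, sgnReal_mul_self]
  simp_rw [hsymm] at hsum
  have hd : (d : ℝ) ≠ 0 := by
    have := i.pos; positivity
  rw [signCorr, ← hsum]
  simp [hd]

/-- The coordinatewise reflection by `u` preserves the Gaussian measure and reduces this to the
all-plus case. -/
lemma integral_sgnReal_signs_mul {d : ℕ} (u : Fin d → Bool) (i : Fin d) :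
    ∫ x, sgnReal (∑ c, sgn (u c) * x c) * x i ∂gaussianPi d = sgn (u i) * signCorr d := by
  have h1 : ∀ b : Bool, MeasurePreserving (fun x : ℝ => sgn b * x)
      (gaussianReal 0 1) (gaussianReal 0 1) := by
    intro b
    refine ⟨by fun_prop, ?_⟩
    rw [gaussianReal_map_const_mul]
    congr 1
    · simp
    · ext; simp [sgn_sq]
  have hmp : MeasurePreserving (fun (x : Fin d → ℝ) c => sgn (u c) * x c)
      (gaussianPi d) (gaussianPi d) := measurePreserving_pi _ _ fun c => h1 (u c)
  have hmeas : Measurable fun x : Fin d → ℝ => sgnReal (∑ c, sgn (u c) * x c) * x i :=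
    (measurable_sgnReal.comp (by fun_prop)).mul (by fun_prop)
  rw [← integral_comp_measurePreserving hmp hmeas, ← integral_sgnReal_sum_mul i,
    ← integral_const_mul]
  refine integral_congr_ae (Filter.Eventually.of_forall fun x => ?_)
  simp only [← mul_assoc, sgn_mul_self, one_mul]
  ring

/-- The normalized sum is standard normal, so its characteristic function at 1 is `exp (-1/2) ≤
2/3`. Integrating `1 - cos y ≤ |y|` then gives first absolute moment at least 1/3. -/
lemma signCorr_ge {d : ℕ} (hd : 1 ≤ d) : 1 / (3 * √d) ≤ signCorr d := by
  have hd0 : (0 : ℝ) < d := by positivity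
  set r := √(d : ℝ) with hr
  have hr0 : 0 < r := Real.sqrt_pos.2 hd0
  have hrr : r ^ 2 = d := Real.sq_sqrt hd0.le
  have habs : ∀ y : ℝ, 1 - Real.cos y ≤ |y| := by
    intro y
    have h1 := Real.one_sub_sq_div_two_le_cos (x := y)
    have h2 := Real.neg_one_le_cos y
    rw [← sq_abs] at h1
    by_cases h : |y| ≤ 2
    · nlinarith [abs_nonneg y]
    · linarith
  have hcos : ∫ x, Real.cos (r⁻¹ * ∑ c, x c) ∂gaussianPi d = Real.exp (-(1 / 2)) := by
    have h := integral_fintype_prod_eq_pow (𝕜 := ℂ) (ι := Fin d) (μ := gaussianReal 0 1)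
      (fun x : ℝ => Complex.exp ((r⁻¹ : ℝ) * x * Complex.I))
    have h0 := charFun_gaussianReal (μ := 0) (v := 1) r⁻¹
    rw [charFun_apply_real] at h0
    have hexp : ∫ x, Complex.exp ((r⁻¹ * ∑ c, x c : ℝ) * Complex.I) ∂gaussianPi d =
        (Real.exp (-(1 / 2)) : ℝ) := by
      rw [h0, Fintype.card_fin, ← Complex.exp_nat_mul] at h
      rw [gaussianPi, Complex.ofReal_exp]
      have e : (d : ℂ) * (r⁻¹ * (0 : ℝ) * Complex.I - (1 : NNReal) * r⁻¹ ^ 2 / 2) =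
          ((-(1 / 2) : ℝ) : ℂ) := by
        have : (d : ℝ) * (r⁻¹ ^ 2) = 1 := by rw [← hrr]; field_simp
        have h' : (d : ℂ) * ((r : ℂ)⁻¹ ^ 2) = 1 := by exact_mod_cast this
        simp only [Complex.ofReal_zero, NNReal.coe_one, Complex.ofReal_one]
        push_cast
        linear_combination (-1 / 2) * h'
      push_cast at h e ⊢
      rw [e] at h
      rw [← h]
      refine integral_congr_ae (Filter.Eventually.of_forall fun x => ?_)
      simp only
      rw [← Complex.exp_sum, Finset.mul_sum, Finset.sum_mul]
    have hre := congrArg Complex.re hexp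
    rw [Complex.ofReal_re] at hre
    rw [← hre]
    have hI : Integrable (fun x : Fin d → ℝ =>
        Complex.exp ((r⁻¹ * ∑ c, x c : ℝ) * Complex.I)) (gaussianPi d) := by
      refine Integrable.of_bound (by fun_prop) 1 (Filter.Eventually.of_forall fun x => ?_)
      rw [Complex.norm_exp_ofReal_mul_I]
    have := integral_re hI
    simp only [RCLike.re_to_complex, Complex.exp_ofReal_mul_I_re] at this
    exact this
  have hlin : Integrable (fun x : Fin d → ℝ => ∑ c, x c) (gaussianPi d) :=
    integrable_finsetSum _ fun i _ => integrable_coord i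
  have hcosI : Integrable (fun x : Fin d → ℝ => Real.cos (r⁻¹ * ∑ c, x c)) (gaussianPi d) :=
    Integrable.of_bound (by fun_prop) 1
      (Filter.Eventually.of_forall fun x => Real.abs_cos_le_one _)
  have hmono : ∫ x, (1 - Real.cos (r⁻¹ * ∑ c, x c)) ∂gaussianPi d ≤
      ∫ x, r⁻¹ * |∑ c, x c| ∂gaussianPi d := by
    refine integral_mono ((integrable_const _).sub hcosI) (hlin.abs.const_mul _) fun x => ?_
    refine (habs _).trans_eq ?_
    simp [abs_mul, abs_of_pos hr0]
  rw [integral_sub (integrable_const _) hcosI, hcos, integral_const_mul] at hmono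
  simp only [integral_const, probReal_univ, one_smul] at hmono
  have hexp : Real.exp (-(1 / 2)) ≤ 2 / 3 := by
    rw [Real.exp_neg, inv_le_comm₀ (Real.exp_pos _) (by norm_num)]
    have := Real.add_one_le_exp (1 / 2 : ℝ)
    linarith
  rw [signCorr, ← hrr, div_le_div_iff₀ (by positivity) (by positivity)]
  set I := ∫ x, |∑ c, x c| ∂gaussianPi d
  have h3 : 1 / 3 * r ≤ I := by
    have : 1 / 3 ≤ r⁻¹ * I := by linarith
    rw [inv_mul_eq_div, le_div_iff₀ hr0] at this
    exact this
  nlinarith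

lemma integral_sq_linear {d : ℕ} (a : Fin d → ℝ) :
    ∫ x, (∑ i, a i * x i) ^ 2 ∂gaussianPi d = ∑ i, a i ^ 2 := by
  have hm : ∀ i, MemLp (fun x : ℝ => a i * x) 2 (gaussianReal 0 1) := fun i =>
    (memLp_id_gaussianReal 2).const_mul (a i)
  have h := variance_sum_pi (μ := fun _ : Fin d => gaussianReal 0 1) hm
  have h0 : ∫ x, (∑ i, a i * x i) ∂gaussianPi d = 0 := by
    rw [integral_finsetSum _ fun i _ => (integrable_coord i).const_mul _]
    refine Finset.sum_eq_zero fun i _ => ?_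
    rw [integral_const_mul]
    have := integral_comp_eval (μ := fun _ : Fin d => gaussianReal 0 1) (i := i)
      (f := fun x : ℝ => x) (by fun_prop)
    simp [gaussianPi, this]
  have e : (∑ i, fun x : Fin d → ℝ => a i * x i) = fun x => ∑ i, a i * x i := by
    ext x; simp
  rw [e, ← gaussianPi, variance_of_integral_eq_zero (Measurable.aemeasurable (by fun_prop)) h0] at h
  rw [h]
  refine Finset.sum_congr rfl fun i _ => ?_
  rw [variance_const_mul, variance_fun_id_gaussianReal]
  simp

/-! ### Mean and variance of the score -/

variable {d : ℕ} (ρ : EuclideanSpace ℝ (Fin d))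

lemma integral_pairLaw {f : (Fin d → ℝ) × ℝ → ℝ} (hf : Measurable f) :
    ∫ p, f p ∂pairLaw ρ = ∫ p, f (p.1, ∑ i, ρ i * p.1 i + √(1 - ‖ρ‖ ^ 2) * p.2)
      ∂(gaussianPi d).prod (gaussianReal 0 1) := by
  rw [pairLaw, integral_map (by fun_prop) hf.aestronglyMeasurable]
  rfl

lemma memLp_output : MemLp (fun p : (Fin d → ℝ) × ℝ => p.2) 2 (pairLaw ρ) := by
  rw [pairLaw, memLp_map_measure_iff (by fun_prop) (by fun_prop)]
  have h1 : MemLp (fun p : (Fin d → ℝ) × ℝ => ∑ i, ρ i * p.1 i) 2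
      ((gaussianPi d).prod (gaussianReal 0 1)) :=
    memLp_finsetSum _ fun i _ =>
      ((memLp_coord i).const_mul (ρ i)).comp_measurePreserving measurePreserving_fst
  have h2 : MemLp (fun p : (Fin d → ℝ) × ℝ => √(1 - ‖ρ‖ ^ 2) * p.2) 2
      ((gaussianPi d).prod (gaussianReal 0 1)) :=
    ((memLp_id_gaussianReal 2).const_mul _).comp_measurePreserving measurePreserving_snd
  exact h1.add h2

/-- The product of the bit sent for one sample and the observation of the second party. -/
noncomputable def score (u : Fin d → Bool) (p : (Fin d → ℝ) × ℝ) : ℝ :=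
  sgnReal (∑ c, sgn (u c) * p.1 c) * p.2

lemma measurable_score (u : Fin d → Bool) : Measurable (score u) :=
  (measurable_sgnReal.comp (by fun_prop)).mul measurable_snd

lemma memLp_score (u : Fin d → Bool) : MemLp (score u) 2 (pairLaw ρ) :=
  (memLp_output ρ).of_le (measurable_score u).aestronglyMeasurable
    (Filter.Eventually.of_forall fun p => by
      rw [score, norm_mul, norm_sgnReal, one_mul])

/-- The noise `Z` is centred and independent of the sign, so only the linear part of `Y`
contributes. -/
lemma integral_score (u : Fin d → Bool) :
    ∫ p, score u p ∂pairLaw ρ = signCorr d * ∑ i, sgn (u i) * ρ i := by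
  rw [integral_pairLaw ρ (measurable_score u)]
  have hs : Measurable fun x : Fin d → ℝ => ∑ c, sgn (u c) * x c := by fun_prop
  have e : ∀ p : (Fin d → ℝ) × ℝ,
      score u (p.1, ∑ i, ρ i * p.1 i + √(1 - ‖ρ‖ ^ 2) * p.2) =
      (∑ i, ρ i * (sgnReal (∑ c, sgn (u c) * p.1 c) * p.1 i)) +
        (sgnReal (∑ c, sgn (u c) * p.1 c)) * (√(1 - ‖ρ‖ ^ 2) * p.2) := by
    intro p
    rw [score, mul_add, Finset.mul_sum]
    congr 1
    exact Finset.sum_congr rfl fun i _ => by ring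
  have hi : ∀ i, Integrable (fun x => ρ i * (sgnReal (∑ c, sgn (u c) * x c) * x i))
      (gaussianPi d) := fun i =>
    (integrable_sgnReal_mul hs (integrable_coord i)).const_mul _
  have hZ : Integrable (fun z : ℝ => √(1 - ‖ρ‖ ^ 2) * z) (gaussianReal 0 1) :=
    ((memLp_id_gaussianReal 1).integrable le_rfl).const_mul _
  have h1 : Integrable (fun p : (Fin d → ℝ) × ℝ =>
      ∑ i, ρ i * (sgnReal (∑ c, sgn (u c) * p.1 c) * p.1 i))
      ((gaussianPi d).prod (gaussianReal 0 1)) :=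
    (integrable_finsetSum _ fun i _ => hi i).comp_fst _
  have h2 : Integrable (fun p : (Fin d → ℝ) × ℝ =>
      (sgnReal (∑ c, sgn (u c) * p.1 c)) * (√(1 - ‖ρ‖ ^ 2) * p.2))
      ((gaussianPi d).prod (gaussianReal 0 1)) :=
    integrable_sgnReal_mul (hs.comp measurable_fst) (hZ.comp_snd _)
  simp_rw [e]
  rw [integral_add h1 h2, integral_prod_mul (fun x : Fin d → ℝ => sgnReal (∑ c, sgn (u c) * x c))
      (fun z : ℝ => √(1 - ‖ρ‖ ^ 2) * z),
    integral_fun_fst (fun x : Fin d → ℝ => ∑ i, ρ i * (sgnReal (∑ c, sgn (u c) * x c) * x i)),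
    integral_finsetSum _ fun i _ => hi i, integral_const_mul]
  simp only [integral_const_mul, integral_sgnReal_signs_mul, integral_id_gaussianReal, mul_zero,
    add_zero, probReal_univ, one_smul]
  rw [Finset.mul_sum]
  exact Finset.sum_congr rfl fun i _ => by ring

/-- The squared score is `Y ^ 2`, whose mean is `‖ρ‖ ^ 2 + (1 - ‖ρ‖ ^ 2) = 1`. -/
lemma variance_score_le (hρ : ‖ρ‖ ≤ 1) (u : Fin d → Bool) : Var[score u; pairLaw ρ] ≤ 1 := by
  refine (variance_le_expectation_sq (measurable_score u).aestronglyMeasurable).trans ?_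
  have e : (score u ^ 2 : (Fin d → ℝ) × ℝ → ℝ) = fun p => p.2 ^ 2 := by
    ext p; simp [score, mul_pow, sgnReal_sq]
  rw [e, integral_pairLaw ρ (by fun_prop)]
  set b := √(1 - ‖ρ‖ ^ 2) with hb
  have hb2 : b ^ 2 = 1 - ‖ρ‖ ^ 2 := Real.sq_sqrt (by nlinarith [norm_nonneg ρ])
  have hl : MemLp (fun x : Fin d → ℝ => ∑ i, ρ i * x i) 2 (gaussianPi d) :=
    memLp_finsetSum _ fun i _ => (memLp_coord i).const_mul (ρ i)
  have hz : MemLp (fun z : ℝ => z) 2 (gaussianReal 0 1) := memLp_id_gaussianReal 2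
  have h1 : Integrable (fun p : (Fin d → ℝ) × ℝ => (∑ i, ρ i * p.1 i) ^ 2)
    ((gaussianPi d).prod (gaussianReal 0 1)) := hl.integrable_sq.comp_fst _
  have h2 : Integrable (fun p : (Fin d → ℝ) × ℝ => (∑ i, ρ i * p.1 i) * (2 * b * p.2))
    ((gaussianPi d).prod (gaussianReal 0 1)) :=
    (hl.integrable (by norm_num)).mul_prod ((hz.integrable (by norm_num)).const_mul _)
  have h3 : Integrable (fun p : (Fin d → ℝ) × ℝ => b ^ 2 * p.2 ^ 2)
    ((gaussianPi d).prod (gaussianReal 0 1)) := (hz.integrable_sq.const_mul _).comp_snd _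
  have e2 : ∀ p : (Fin d → ℝ) × ℝ, (∑ i, ρ i * p.1 i + b * p.2) ^ 2 =
    (∑ i, ρ i * p.1 i) ^ 2 + (∑ i, ρ i * p.1 i) * (2 * b * p.2) + b ^ 2 * p.2 ^ 2 :=
    fun p => by ring
  have hvar : ∫ z, z ^ 2 ∂gaussianReal 0 1 = 1 := by
    have := variance_fun_id_gaussianReal (μ := 0) (v := 1)
    rw [variance_of_integral_eq_zero (by fun_prop) (by simp)] at this
    simpa using this
  simp_rw [e2]
  rw [integral_add (f := fun p : (Fin d → ℝ) × ℝ => (∑ i, ρ i * p.1 i) ^ 2 +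
    (∑ i, ρ i * p.1 i) * (2 * b * p.2)) (h1.add h2) h3, integral_add h1 h2,
    integral_prod_mul (fun x : Fin d → ℝ => ∑ i, ρ i * x i) (fun z : ℝ => 2 * b * z),
    integral_fun_fst (fun x : Fin d → ℝ => (∑ i, ρ i * x i) ^ 2),
    integral_fun_snd (fun z : ℝ => b ^ 2 * z ^ 2), integral_const_mul, integral_const_mul,
    integral_sq_linear, hvar]
  simp [hb2, EuclideanSpace.norm_sq_eq]

/-! ### Firing probability of a single block -/

/-- The uniform distribution on sign vectors. -/
noncomputable def signLaw (d : ℕ) : Measure (Fin d → Bool) := uniformOn Set.univ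

instance (d : ℕ) : IsProbabilityMeasure (signLaw d) :=
  isProbabilityMeasure_uniformOn Set.finite_univ Set.univ_nonempty

/-- The law of one block of `m` samples together with its random sign vector. -/
noncomputable def blockLaw {d : ℕ} (m : ℕ) (ρ : EuclideanSpace ℝ (Fin d)) :
    Measure ((Fin m → (Fin d → ℝ) × ℝ) × (Fin d → Bool)) :=
  (sampleLaw m ρ).prod (signLaw d)

instance {d : ℕ} (n : ℕ) (ρ : EuclideanSpace ℝ (Fin d)) : IsProbabilityMeasure (sampleLaw n ρ) := by
  unfold sampleLaw; infer_instance

instance {d : ℕ} (m : ℕ) (ρ : EuclideanSpace ℝ (Fin d)) : IsProbabilityMeasure (blockLaw m ρ) := by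
  unfold blockLaw; infer_instance

/-- The blocks whose empirical correlation is significantly different from zero. -/
def firing (d m : ℕ) : Set ((Fin m → (Fin d → ℝ) × ℝ) × (Fin d → Bool)) :=
  {w | 8 * √m ≤ |∑ k, score w.2 (w.1 k)|}

lemma measurableSet_firing (d m : ℕ) : MeasurableSet (firing d m) := by
  refine measurableSet_le measurable_const (Measurable.abs (Finset.measurable_fun_sum _ fun k _ => ?_))
  exact (measurable_from_prod_countable_left fun u => (measurable_score u).comp
    (measurable_pi_apply k) : Measurable fun w : (Fin m → (Fin d → ℝ) × ℝ) × (Fin d → Bool) =>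
      score w.2 (w.1 k))

section Block

variable {d m : ℕ} (ρ : EuclideanSpace ℝ (Fin d))

/-- Chebyshev: the variance is at most `m`, against a squared deviation of `64 * m`. -/
lemma measure_deviation_le (hρ : ‖ρ‖ ≤ 1) (hm : 1 ≤ m) (u : Fin d → Bool) :
    (Measure.pi fun _ : Fin m => pairLaw ρ)
      {s | 8 * √m ≤ |∑ k, score u (s k) - m * (signCorr d * ∑ i, sgn (u i) * ρ i)|} ≤
        ENNReal.ofReal (1 / 64) := by
  have hm0 : (0 : ℝ) < m := by positivity
  have hL : ∀ k : Fin m, MemLp (fun s : Fin m → (Fin d → ℝ) × ℝ => score u (s k)) 2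
      (Measure.pi fun _ => pairLaw ρ) := fun k =>
    (memLp_score ρ u).comp_measurePreserving (measurePreserving_eval _ k)
  have hmean : ∫ s, ∑ k, score u (s k) ∂(Measure.pi fun _ : Fin m => pairLaw ρ) =
      m * (signCorr d * ∑ i, sgn (u i) * ρ i) := by
    rw [integral_finsetSum _ fun k _ => (hL k).integrable (by norm_num)]
    have : ∀ k : Fin m, ∫ s, score u (s k) ∂(Measure.pi fun _ : Fin m => pairLaw ρ) =
        signCorr d * ∑ i, sgn (u i) * ρ i := by
      intro k
      rw [integral_comp_eval (μ := fun _ : Fin m => pairLaw ρ)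
        (measurable_score u).aestronglyMeasurable, integral_score]
    simp [this]
  have hvar := variance_sum_pi (μ := fun _ : Fin m => pairLaw ρ) fun _ => memLp_score ρ u
  have e : (∑ k : Fin m, fun s : Fin m → (Fin d → ℝ) × ℝ => score u (s k)) =
      fun s => ∑ k, score u (s k) := by
    ext s; simp
  rw [e] at hvar
  have hC := meas_ge_le_variance_div_sq (memLp_finsetSum Finset.univ fun k _ => hL k)
    (show 0 < 8 * √(m : ℝ) by positivity)
  rw [hmean, hvar] at hC
  refine hC.trans (ENNReal.ofReal_le_ofReal ?_)
  rw [mul_pow, Real.sq_sqrt hm0.le, div_le_iff₀ (by positivity)]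
  refine (Finset.sum_le_card_nsmul _ _ 1 fun k _ => variance_score_le ρ hρ u).trans ?_
  simp
  linarith

lemma blockLaw_zero_firing_le (hm : 1 ≤ m) :
    (blockLaw m (0 : EuclideanSpace ℝ (Fin d))).real (firing d m) ≤ 1 / 64 := by
  refine ENNReal.toReal_le_of_le_ofReal (by norm_num) ?_
  rw [blockLaw, Measure.prod_apply_symm (measurableSet_firing d m)]
  refine (lintegral_mono (g := fun _ => ENNReal.ofReal (1 / 64)) fun u => ?_).trans (by simp)
  refine (measure_mono ?_).trans
    (measure_deviation_le (0 : EuclideanSpace ℝ (Fin d)) (by simp) hm u)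
  intro s hs
  simpa [firing] using hs

lemma signLaw_small_le :
    signLaw d {u | (∑ i, sgn (u i) * ρ i) ^ 2 < ‖ρ‖ ^ 2 / 4} ≤ ENNReal.ofReal (4 / 5) := by
  have h := card_small_signs_sum_le fun i => ρ i
  rw [signLaw, uniformOn_univ]
  have e : {u : Fin d → Bool | (∑ i, sgn (u i) * ρ i) ^ 2 < ‖ρ‖ ^ 2 / 4} =
      ((Finset.univ.filter fun u : Fin d → Bool =>
        (∑ i, sgn (u i) * ρ i) ^ 2 < (∑ i, ρ i ^ 2) / 4 : Finset _) : Set _) := by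
    ext u; simp [EuclideanSpace.norm_sq_eq]
  rw [e, Measure.count_apply_finset]
  refine ENNReal.div_le_of_le_mul ?_
  rw [← ENNReal.ofReal_natCast, ← ENNReal.ofReal_natCast (Fintype.card _),
    ← ENNReal.ofReal_mul (by norm_num)]
  refine ENNReal.ofReal_le_ofReal (h.trans_eq ?_)
  simp

/-- A silent block needs either a bad sign vector (probability at most 4/5) or a large deviation
from the mean (at most 1/64). -/
lemma blockLaw_not_firing_le {τ : ℝ} (hd : 1 ≤ d) (hτ : 0 < τ) (hρ : ‖ρ‖ ≤ 1) (hτρ : τ ≤ ‖ρ‖)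
    (hm : 9216 * (d / τ ^ 2) ≤ m) :
    (blockLaw m ρ).real (firing d m)ᶜ ≤ 4 / 5 + 1 / 64 := by
  have hd0 : (0 : ℝ) < d := by positivity
  have hm0 : (0 : ℝ) < m := lt_of_lt_of_le (by positivity) hm
  have hm1 : 1 ≤ m := by exact_mod_cast hm0
  refine ENNReal.toReal_le_of_le_ofReal (by norm_num) ?_
  rw [blockLaw, Measure.prod_apply_symm (measurableSet_firing d m).compl]
  set B : Set (Fin d → Bool) := {u | (∑ i, sgn (u i) * ρ i) ^ 2 < ‖ρ‖ ^ 2 / 4} with hB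
  have hBm : MeasurableSet B := Set.Finite.measurableSet (Set.toFinite B)
  have hbound : ∀ u, sampleLaw m ρ
      ((fun s => (s, u)) ⁻¹' (firing d m)ᶜ) ≤
        B.indicator (fun _ => 1) u + ENNReal.ofReal (1 / 64) := by
    intro u
    by_cases hu : u ∈ B
    · rw [Set.indicator_of_mem hu]
      exact prob_le_one.trans le_self_add
    · rw [Set.indicator_of_notMem hu, zero_add]
      refine (measure_mono ?_).trans (measure_deviation_le ρ hρ hm1 u)
      intro s hs
      simp only [firing, Set.mem_preimage, Set.mem_compl_iff, Set.mem_ofPred_eq, not_le] at hs ⊢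
      have hu' : τ ^ 2 / 4 ≤ (∑ i, sgn (u i) * ρ i) ^ 2 := by
        have h1 : ‖ρ‖ ^ 2 / 4 ≤ (∑ i, sgn (u i) * ρ i) ^ 2 := by simpa [hB] using hu
        have h2 : τ ^ 2 ≤ ‖ρ‖ ^ 2 := by gcongr
        linarith
      set R := ∑ i, sgn (u i) * ρ i
      -- Twice the firing threshold, so a silent block deviates by at least `8 * √m`. Squared, this
      -- requires `m * τ ^ 2 / (36 * d) ≥ 256`, which is where `9216 = 36 * 256` comes from.
      have hmean : 16 * √m ≤ |m * (signCorr d * R)| := by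
        refine abs_le_of_sq_le_sq' ?_ (abs_nonneg _) |>.2
        rw [sq_abs, mul_pow, Real.sq_sqrt hm0.le, mul_pow, mul_pow]
        have hc : 1 / (9 * d) ≤ signCorr d ^ 2 := by
          have := pow_le_pow_left₀ (by positivity) (signCorr_ge hd) 2
          rw [div_pow, mul_pow, Real.sq_sqrt hd0.le] at this
          norm_num at this ⊢
          exact this
        have hcR : 1 / (9 * d) * (τ ^ 2 / 4) ≤ signCorr d ^ 2 * R ^ 2 :=
          mul_le_mul hc hu' (by positivity) (sq_nonneg _)
        have h256 : 256 ≤ m * (1 / (9 * d) * (τ ^ 2 / 4)) := by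
          rw [← mul_div_assoc, div_le_iff₀ (by positivity)] at hm
          have : (m : ℝ) * (1 / (9 * d) * (τ ^ 2 / 4)) = m * τ ^ 2 / (36 * d) := by
            field_simp; norm_num
          rw [this, le_div_iff₀ (by positivity)]
          linarith
        nlinarith [mul_le_mul_of_nonneg_left hcR hm0.le]
      have htri := abs_sub_abs_le_abs_sub (m * (signCorr d * R)) (∑ k, score u (s k))
      rw [abs_sub_comm] at htri
      linarith
  refine (lintegral_mono hbound).trans ?_
  rw [lintegral_add_right _ measurable_const, lintegral_indicator_const hBm, one_mul,
    lintegral_const, measure_univ, mul_one, ENNReal.ofReal_add (by norm_num) (by norm_num)]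
  gcongr
  exact signLaw_small_le ρ

end Block

/-! ### The block test and its error probabilities -/

section Test

variable {d n m K : ℕ}

/-- The position of sample `k` of block `j`. -/
def position (h : 8 * K * m ≤ n) (p : Fin (8 * K) × Fin m) : Fin n :=
  Fin.castLE h (finProdFinEquiv p)

lemma position_injective (h : 8 * K * m ≤ n) : Function.Injective (position h) :=
  (Fin.castLE_injective h).comp finProdFinEquiv.injective

/-- The test that splits the samples into `8 * K` blocks of length `m`, projects the samples of each
block on a shared random sign vector, and decides for correlation if at least `K` blocks fire. -/
noncomputable def blockTest (h : 8 * K * m ≤ n) : OneWayTest d n (8 * K * m) where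
  V := Fin (8 * K) → Fin d → Bool
  law := Measure.pi fun _ => signLaw d
  encode p i := decide (0 ≤ ∑ c, sgn (p.2 (finProdFinEquiv.symm i).1 c) * p.1 (Fin.castLE h i) c)
  measurable_encode := by
    refine measurable_from_prod_countable_left fun v => measurable_pi_lambda _ fun i => ?_
    refine measurable_to_bool ?_
    have : Measurable fun x : Fin n → Fin d → ℝ =>
      ∑ c, sgn (v (finProdFinEquiv.symm i).1 c) * x (Fin.castLE h i) c := by fun_prop
    convert this (measurableSet_Ici : MeasurableSet (Set.Ici (0 : ℝ))) using 1
    ext x; simp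
  decision q := decide (∑ j, (if 8 * √m ≤
    |∑ k, sgn (q.2.1 (finProdFinEquiv (j, k))) * q.1 (position h (j, k))| then 1 else 0) < K)
  measurable_decision := by
    refine measurable_from_prod_countable_left fun v => measurable_to_bool ?_
    have : Measurable fun y : Fin n → ℝ => ∑ j, (if 8 * √m ≤
        |∑ k, sgn (v.1 (finProdFinEquiv (j, k))) * y (position h (j, k))| then 1 else 0) :=
      Finset.measurable_fun_sum _ fun j _ => Measurable.ite
        (measurableSet_le measurable_const (by fun_prop)) measurable_const measurable_const
    convert this (MeasurableSet.of_discrete (s := Set.Iio K)) using 1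
    ext y; simp

open Classical in
lemma blockTest_output (h : 8 * K * m ≤ n) (s : Fin n → (Fin d → ℝ) × ℝ)
    (v : Fin (8 * K) → Fin d → Bool) :
    (blockTest h).output s v = decide ((∑ j, if ((fun k => s (position h (j, k)), v j) :
      (Fin m → (Fin d → ℝ) × ℝ) × (Fin d → Bool)) ∈ firing d m then 1 else 0) < K) := by
  simp only [OneWayTest.output, blockTest, firing, score, sgnReal, Set.mem_ofPred_eq,
    Equiv.symm_apply_apply, position]

open Classical in
lemma blockTest_probOutput (h : 8 * K * m ≤ n) (ρ : EuclideanSpace ℝ (Fin d)) (b : Bool) :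
    (blockTest h).probOutput ρ b = (Measure.pi fun _ : Fin (8 * K) => blockLaw m ρ).real
      {w | decide ((∑ j, if w j ∈ firing d m then 1 else 0) < K) = b} := by
  have hmp := measurePreserving_blocks (pairLaw ρ) (signLaw d) (position_injective h)
  have hmeas : Measurable fun w : Fin (8 * K) → (Fin m → (Fin d → ℝ) × ℝ) × (Fin d → Bool) =>
      ∑ j, if w j ∈ firing d m then 1 else 0 :=
    Finset.measurable_fun_sum _ fun j _ => Measurable.ite
      (measurable_pi_apply j (measurableSet_firing d m)) measurable_const measurable_const
  have hset : MeasurableSet {w : Fin (8 * K) → (Fin m → (Fin d → ℝ) × ℝ) × (Fin d → Bool) |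
      decide ((∑ j, if w j ∈ firing d m then 1 else 0) < K) = b} :=
    hmeas (MeasurableSet.of_discrete (s := {c : ℕ | decide (c < K) = b}))
  have := hmp.measureReal_preimage hset.nullMeasurableSet
  refine Eq.trans ?_ this
  refine congrArg ((sampleLaw n ρ).prod (Measure.pi fun _ => signLaw d)).real ?_
  ext ω
  exact iff_of_eq (congrArg (· = b) (blockTest_output h ω.1 ω.2))

lemma blockTest_probOutput_zero_le (h : 8 * K * m ≤ n) (hm : 1 ≤ m) :
    (blockTest h).probOutput (0 : EuclideanSpace ℝ (Fin d)) false ≤ (15 / 16) ^ K := by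
  classical
  rw [blockTest_probOutput]
  -- With `x = 1` the base is `(65/64) ^ 8 / 2`, below 15/16.
  have := chernoff_count _ (measurableSet_firing d m) (blockLaw_zero_firing_le hm) zero_le_one
    (8 * K) K
  have e : {w : Fin (8 * K) → (Fin m → (Fin d → ℝ) × ℝ) × (Fin d → Bool) |
      decide ((∑ j, if w j ∈ firing d m then 1 else 0) < K) = false} =
      {w | K ≤ ∑ j, if w j ∈ firing d m then 1 else 0} := by
    ext w; simp
  rw [e]
  refine this.trans ?_
  rw [pow_mul, ← div_pow]
  exact pow_le_pow_left₀ (by norm_num) (by norm_num) _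

lemma blockTest_probOutput_correlated_le (h : 8 * K * m ≤ n) {ρ : EuclideanSpace ℝ (Fin d)} {τ : ℝ}
    (hd : 1 ≤ d) (hτ : 0 < τ) (hρ : ‖ρ‖ ≤ 1) (hτρ : τ ≤ ‖ρ‖) (hm : 9216 * (d / τ ^ 2) ≤ m) :
    (blockTest h).probOutput ρ true ≤ (15 / 16) ^ K := by
  classical
  rw [blockTest_probOutput]
  -- Fewer than `K` firing blocks means more than `7 * K` silent ones; `x = 1/4` brings the base
  -- just below 15/16.
  have := chernoff_count _ (measurableSet_firing d m).compl
    (blockLaw_not_firing_le ρ hd hτ hρ hτρ hm) (x := 1 / 4) (by norm_num) (8 * K) (7 * K)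
  refine (measureReal_mono ?_).trans (this.trans ?_)
  · intro w hw
    simp only [Set.mem_ofPred_eq, decide_eq_true_eq, Set.mem_compl_iff] at hw ⊢
    have hsum : (∑ j, if w j ∈ firing d m then 1 else 0) +
        (∑ j, if w j ∉ firing d m then 1 else 0) = 8 * K := by
      rw [← Finset.sum_add_distrib, Finset.sum_congr rfl (g := fun _ => 1)]
      · simp
      · intro j _; by_cases hj : w j ∈ firing d m <;> simp [hj]
    omega
  · rw [pow_mul, pow_mul, ← div_pow]
    exact pow_le_pow_left₀ (by norm_num) (by norm_num) _

end Test

/-! ### Choice of parameters -/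

lemma achievable_blocks {d K m : ℕ} {δ ε τ : ℝ} (hd : 1 ≤ d) (hτ : 0 < τ)
    (hm : 9216 * (d / τ ^ 2) ≤ m) (hδ : (15 / 16) ^ K ≤ δ) (hε : (15 / 16) ^ K ≤ ε) :
    Achievable d δ ε τ (8 * K * m) := by
  have hm0 : (0 : ℝ) < m := lt_of_lt_of_le (by positivity) hm
  have hm1 : 1 ≤ m := by exact_mod_cast hm0
  exact ⟨8 * K * m, fun n hn => ⟨blockTest hn,
    fun ρ hρ hτρ => (blockTest_probOutput_correlated_le hn hd hτ hρ hτρ hm).trans hδ,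
    (blockTest_probOutput_zero_le hn hm1).trans hε⟩⟩

/-- The test that ignores the samples and tosses a biased shared coin. -/
noncomputable def coinTest (d n : ℕ) (p : unitInterval) : OneWayTest d n 0 where
  V := Bool
  law := bernoulliMeasure true false p
  encode _ i := i.elim0
  measurable_encode := measurable_pi_lambda _ fun i => i.elim0
  decision q := q.2.2
  measurable_decision := by fun_prop

/-- A coin showing `true` with probability `δ` errs with probability `δ` under correlation and `1 -
δ ≤ ε` under independence. -/
lemma achievable_zero {d : ℕ} {δ ε τ : ℝ} (hδ0 : 0 < δ) (hδ1 : δ < 1) (h : 1 ≤ δ + ε) :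
    Achievable d δ ε τ 0 := by
  have hprob : ∀ (n : ℕ) (ρ : EuclideanSpace ℝ (Fin d)) (b : Bool),
      (coinTest d n ⟨δ, hδ0.le, hδ1.le⟩).probOutput ρ b =
        (bernoulliMeasure true false ⟨δ, hδ0.le, hδ1.le⟩).real {b} := by
    intro n ρ b
    have := (measurePreserving_snd (μ := sampleLaw n ρ)
      (ν := bernoulliMeasure true false ⟨δ, hδ0.le, hδ1.le⟩)).measureReal_preimage
      (MeasurableSet.singleton b).nullMeasurableSet
    rw [← this]
    rfl
  refine ⟨0, fun n _ => ⟨coinTest d n ⟨δ, hδ0.le, hδ1.le⟩, fun ρ _ _ => ?_, ?_⟩⟩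
  · rw [hprob, bernoulliMeasure_real_apply_of_mem_of_notMem] <;> simp
  · rw [hprob, bernoulliMeasure_real_apply_of_notMem_of_mem] <;> simp
    linarith

/-- The factor 11 works because `(15 / 16) ^ 11 ≤ 1 / 2`. -/
lemma pow_le_of_logb_le {x L : ℝ} {K : ℕ} (hx : 0 < x) (hL : Real.logb 2 (1 / x) ≤ L)
    (hK : 11 * L ≤ K) : (15 / 16 : ℝ) ^ K ≤ x := by
  have h1 : -Real.logb 2 x * 11 ≤ K := by
    rw [one_div, Real.logb_inv] at hL; linarith
  have h2 : ((15 / 16 : ℝ) ^ K) ^ 11 ≤ (1 / 2) ^ K := by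
    rw [← pow_mul, mul_comm, pow_mul]
    exact pow_le_pow_left₀ (by norm_num) (by norm_num) _
  refine le_of_pow_le_pow_left₀ (n := 11) (by norm_num) hx.le (h2.trans ?_)
  rw [← Real.logb_le_logb (b := 2) (by norm_num) (by positivity) (by positivity), Real.logb_pow,
    Real.logb_pow, one_div, Real.logb_inv, Real.logb_self_eq_one (by norm_num)]
  push_cast
  linarith

end CorrelationTesting

theorem theorem2 :
    ∃ c : ℝ, 0 < c ∧ ∃ K : ℝ, 0 < K ∧
      ∀ (d : ℕ) (τ δ ε : ℝ), 1 ≤ d → 0 < τ → τ ≤ 1 → 0 < δ → δ < 1 → 0 < ε → ε < 1 →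
        ((CorrelationTesting.minOneWayComm d δ ε τ : ℝ≥0∞) : EReal) ≤
          ((c * (d / τ ^ 2) * max (Real.logb 2 (1 / δ)) (Real.logb 2 (1 / ε)) +
            K * Real.log (d / τ ^ 2) : ℝ) : EReal) := by
  refine ⟨884832, by norm_num, 1, one_pos, fun d τ δ ε hd hτ hτ1 hδ hδ1 hε hε1 => ?_⟩
  have hd1 : (1 : ℝ) ≤ d := by exact_mod_cast hd
  set D : ℝ := d / τ ^ 2 with hD
  have hD1 : 1 ≤ D := by
    rw [hD, le_div_iff₀ (by positivity)]
    nlinarith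
  set L := max (Real.logb 2 (1 / δ)) (Real.logb 2 (1 / ε)) with hL
  have hlog : 0 ≤ Real.log D := Real.log_nonneg hD1
  have key : ∀ ℓ : ℕ, CorrelationTesting.Achievable d δ ε τ ℓ → (ℓ : ℝ) ≤ 884832 * D * L →
      ((CorrelationTesting.minOneWayComm d δ ε τ : ℝ≥0∞) : EReal) ≤
        ((884832 * D * L + 1 * Real.log D : ℝ) : EReal) := by
    intro ℓ hℓ hle
    have h1 : CorrelationTesting.minOneWayComm d δ ε τ ≤ ℓ := iInf₂_le ℓ hℓ
    have h2 : ((CorrelationTesting.minOneWayComm d δ ε τ : ℝ≥0∞) : EReal) ≤ ((ℓ : ℝ) : EReal) := by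
      have h3 : (CorrelationTesting.minOneWayComm d δ ε τ : ℝ≥0∞) ≤ (ℓ : ℝ≥0∞) := by
        exact_mod_cast ENat.toENNReal_le.2 h1
      refine (EReal.coe_ennreal_le_coe_ennreal_iff.2 h3).trans_eq ?_
      simpa using EReal.coe_nnreal_eq_coe_real (ℓ : NNReal)
    exact h2.trans (EReal.coe_le_coe_iff.2 (by linarith))
  -- When both errors are near 1, `L` is near 0 and rounding up would break the bound, so the coin
  -- handles `δ + ε ≥ 1`. Otherwise one error is at most 1/2 and `L ≥ 1`.
  by_cases hδε : 1 ≤ δ + ε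
  · refine key 0 (CorrelationTesting.achievable_zero hδ hδ1 hδε) ?_
    have hL0 : 0 ≤ L := le_max_of_le_left
      (Real.logb_nonneg (by norm_num) ((one_le_div hδ).2 hδ1.le))
    simp only [Nat.cast_zero]
    positivity
  · have hL1 : 1 ≤ L := by
      have h2 : ∀ x : ℝ, 0 < x → x ≤ 1 / 2 → 1 ≤ Real.logb 2 (1 / x) := by
        intro x hx hx2
        rw [Real.le_logb_iff_rpow_le (by norm_num) (by positivity), Real.rpow_one,
          le_div_iff₀ hx]
        linarith
      rcases le_total δ (1 / 2) with h | h
      · exact le_max_of_le_left (h2 δ hδ h)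
      · exact le_max_of_le_right (h2 ε hε (by linarith))
    have hK := Nat.le_ceil (11 * L)
    have hm := Nat.le_ceil (9216 * D)
    refine key (8 * ⌈11 * L⌉₊ * ⌈9216 * D⌉₊) (CorrelationTesting.achievable_blocks hd hτ hm
      (CorrelationTesting.pow_le_of_logb_le hδ (le_max_left _ _) hK)
      (CorrelationTesting.pow_le_of_logb_le hε (le_max_right _ _) hK)) ?_
    have hK' := Nat.ceil_lt_add_one (show 0 ≤ 11 * L by positivity)
    have hm' := Nat.ceil_lt_add_one (show 0 ≤ 9216 * D by positivity)
    push_cast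
    -- Since `L` and `D` are at least 1, each ceiling costs at most one more `L` or `D`; `884832 = 8
    -- * 12 * 9217`.
    calc (8 * (⌈11 * L⌉₊ : ℝ)) * ⌈9216 * D⌉₊ ≤ (8 * (12 * L)) * (9217 * D) := by
          gcongr <;> linarith
      _ = 884832 * D * L := by ring
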